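/- Let $P$ be a $2$-truncated cube, i.e. a combinatorial simple polytope obtained from the cube $I^n$ by a fixed finite sequence of $2$-truncations $I^n=P_0,P_1,\dots,P_m=P$: for each $k$, $P_k$ is obtained from $P_{k-1}$ by truncating a face $G_k$ of codimension $2$, which means that the simplicial complex $\partial P_k^*$ is the stellar subdivision of $\partial P_{k-1}^*$ along the simplex corresponding to $G_k$; the new vertex corresponds to the new facet $F_k\cong G_k\times I$ of $P_k$ (the section facet). Define, for every nonempty face $Q$ of $P$ (including $Q=P$), a simplicial complex $\Delta(Q)$ on the vertex set $\{w(F_1),\dots,w(F_m)\}$ recursively as follows. For $P_0=I^n$, $\Delta(Q)=\emptyset$ (no vertices, only the empty simplex) for all faces $Q$. Suppose $\Delta$ is defined on the faces of $P_{k-1}$, and let $\tilde Q$ be a nonempty face of $P_k$. (a) If $\tilde Q\not\subset F_k$, let $Q$ be the face of $P_{k-1}$ such that the facets of $P_{k-1}$ containing $Q$ are those corresponding to the facets of $P_k$ containing $\tilde Q$. If $G_k\cap Q$ is nonempty and of codimension $2$ in $Q$ (so that $\tilde Q$ is obtained from $Q$ by $2$-truncation of $G_k\cap Q$), put $\Delta(\tilde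 Q)=\Delta(Q)\cup\bigl(\Delta(G_k\cap Q)\star w(F_k)\bigr)$, where $\star$ denotes the join; otherwise put $\Delta(\tilde Q)=\Delta(Q)$. (b) If $\tilde Q\subset F_k\cong G_k\times I$, then $\tilde Q$ is $Q\times I$ or a copy $Q\times\{0\}$, $Q\times\{1\}$ of $Q$ for a unique face $Q\subset G_k$ of $P_{k-1}$, and $\Delta(\tilde Q)=\Delta(Q)$. Then the function $\Delta$ is monotone: if $Q_1\subset Q_2$ are nonempty faces of $P$, then $\Delta(Q_1)\subset\Delta(Q_2)$. -/

import Mathlib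

noncomputable section

open scoped Classical

namespace TwoTruncatedCube

/-- Stellar subdivision of `K` along the simplex `g` with new vertex `v`: the simplices containing
`g` are removed, and the cone with apex `v` over `∂g * link g` is glued in. -/
def stellar {V : Type*} [DecidableEq V] (K : PreAbstractSimplicialComplex V) (g : Finset V) (v : V) :
    PreAbstractSimplicialComplex V where
  faces := {σ | (σ ∈ K ∧ ¬ g ⊆ σ) ∨ ∃ τ : Finset V, ¬ g ⊆ τ ∧ τ ∪ g ∈ K ∧ σ = insert v τ}
  isRelLowerSet_faces := by
    rintro σ (⟨hσ, hg⟩ | ⟨τ, hg, hτ, rfl⟩)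
    · exact ⟨(K.isRelLowerSet_faces hσ).1, fun ρ hρ hne =>
        Or.inl ⟨(K.isRelLowerSet_faces hσ).2 hρ hne, fun h => hg (h.trans hρ)⟩⟩
    · refine ⟨Finset.insert_nonempty _ _, fun ρ hρ hne => ?_⟩
      by_cases hv : v ∈ ρ
      · refine Or.inr ⟨ρ ∩ τ, fun h => hg (h.trans Finset.inter_subset_right), ?_, ?_⟩
        · refine (K.isRelLowerSet_faces hτ).2
            (Finset.union_subset_union_left Finset.inter_subset_right) ?_
          have : g.Nonempty := by
            rw [Finset.nonempty_iff_ne_empty]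
            rintro rfl
            exact hg (Finset.empty_subset _)
          exact this.mono Finset.subset_union_right
        · ext x
          have := @hρ x
          simp only [Finset.mem_insert, Finset.mem_inter] at this ⊢
          constructor
          · intro hx
            rcases this hx with h | h
            · exact Or.inl h
            · exact Or.inr ⟨hx, h⟩
          · rintro (rfl | h)
            · exact hv
            · exact h.1
      · have hρτ : ρ ⊆ τ := (Finset.subset_insert_iff_of_notMem hv).1 hρ
        exact Or.inl ⟨(K.isRelLowerSet_faces hτ).2 (hρτ.trans Finset.subset_union_left) hne,
          fun h => hg (h.trans hρτ)⟩

/-- The cone (join with a point) `L ⋆ w`. The cone over the empty complex is the point `w`. -/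
def cone {V : Type*} [DecidableEq V] (L : PreAbstractSimplicialComplex V) (w : V) :
    PreAbstractSimplicialComplex V where
  faces := {σ | σ ∈ L ∨ ∃ τ : Finset V, (τ = ∅ ∨ τ ∈ L) ∧ σ = insert w τ}
  isRelLowerSet_faces := by
    rintro σ (hσ | ⟨τ, hτ, rfl⟩)
    · exact ⟨(L.isRelLowerSet_faces hσ).1, fun ρ hρ hne =>
        Or.inl ((L.isRelLowerSet_faces hσ).2 hρ hne)⟩
    · refine ⟨Finset.insert_nonempty _ _, fun ρ hρ hne => ?_⟩
      have key : ∀ α : Finset V, α ⊆ τ → α = ∅ ∨ α ∈ L := by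
        intro α hα
        rcases α.eq_empty_or_nonempty with h | h
        · exact Or.inl h
        · rcases hτ with rfl | hτ
          · exact Or.inl (Finset.subset_empty.1 hα)
          · exact Or.inr ((L.isRelLowerSet_faces hτ).2 hα h)
      by_cases hw : w ∈ ρ
      · exact Or.inr ⟨ρ.erase w, key _ (Finset.subset_insert_iff.1 hρ),
          (Finset.insert_erase hw).symm⟩
      · rcases key ρ ((Finset.subset_insert_iff_of_notMem hw).1 hρ) with h | h
        · exact absurd h hne.ne_empty
        · exact Or.inl h

/-- Names of the facets of an iterated truncation of the cube `I^n`: `Sum.inl (i, ε)` is the facet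
coming from the facet `x_i = ε` of the cube, and `Sum.inr k` is the section facet that
arises in the truncation number `k` (counted from `0`). -/
abbrev Facet (n : ℕ) : Type := (Fin n × Bool) ⊕ ℕ

/-- The boundary complex `∂(I^n)^*` of the polytope dual to the cube (the cross-polytope): a
nonempty set of facets of the cube is a simplex iff it contains no two opposite facets. -/
def cubeComplex (n : ℕ) : PreAbstractSimplicialComplex (Facet n) where
  faces := {σ | σ.Nonempty ∧ (∀ k : ℕ, Sum.inr k ∉ σ) ∧
    ∀ i : Fin n, ¬ (Sum.inl (i, false) ∈ σ ∧ Sum.inl (i, true) ∈ σ)}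
  isRelLowerSet_faces := by
    rintro σ ⟨hne, h1, h2⟩
    exact ⟨hne, fun ρ hρ hne' => ⟨hne', fun k hk => h1 k (hρ hk),
      fun i hi => h2 i ⟨hρ hi.1, hρ hi.2⟩⟩⟩

/-- A combinatorial simple polytope `P` is given by the complex `K = ∂P^*` on its set of facets.
A nonempty face `Q` of `P` (with `Q = P` allowed) is given by the set `σ_Q` of the facets that
contain it: it is empty for `Q = P` and a simplex of `K` otherwise. The codimension of `Q` is the
cardinality of `σ_Q`. -/
@[ext]
structure Face {V : Type*} (K : PreAbstractSimplicialComplex V) where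
  facets : Finset V
  mem : facets = ∅ ∨ facets ∈ K

/-- Inclusion of faces: `Q₁ ⊆ Q₂` iff every facet containing `Q₂` contains `Q₁`. -/
instance {V : Type*} (K : PreAbstractSimplicialComplex V) : PartialOrder (Face K) where
  le Q₁ Q₂ := Q₂.facets ⊆ Q₁.facets
  le_refl _ := Finset.Subset.refl _
  le_trans _ _ _ h₁ h₂ := Finset.Subset.trans h₂ h₁
  le_antisymm _ _ h₁ h₂ := Face.ext (Finset.Subset.antisymm h₂ h₁)

/-- `TruncationSequence n m K`: sequences of `m` successive 2-truncations that start with the cube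
`I^n` and end with the 2-truncated cube `P` with `∂P^* = K`. Each step truncates a face `G` of
codimension 2, given by the set of the two facets containing it; the truncation is the stellar
subdivision along the simplex `G`, and its new vertex is the new section facet. -/
inductive TruncationSequence (n : ℕ) : ℕ → PreAbstractSimplicialComplex (Facet n) → Type
  | cube : TruncationSequence n 0 (cubeComplex n)
  | truncate {m : ℕ} {K : PreAbstractSimplicialComplex (Facet n)}
      (T : TruncationSequence n m K) (G : Finset (Facet n)) (hG : G ∈ K) (hcodim : G.card = 2) :
      TruncationSequence n (m + 1) (stellar K G (Sum.inr m))

namespace TruncationSequence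

/-- The complex `Δ` of the face with set of facets `σ`; only the `σ` that belong to faces matter.
The vertex `w` of the section facet `Sum.inr k` is the number `k`.

In the step from `P` to its truncation along `G`, with section facet `F = Sum.inr m`, let `Q'` be
the face of the new polytope with set of facets `σ`.
* If `F ∈ σ`, then `Q'` lies in the section facet `G × I`, and `Q'` is `Q × I` or a copy `Q × {0}`,
  `Q × {1}` of `Q`, where `Q ⊆ G` is the face of `P` with set of facets `(σ \ {F}) ∪ G`.
* If `F ∉ σ`, then `σ` is also the set of facets of a face `Q` of `P`. If `G ∩ Q` is nonempty
  and has codimension 2 in `Q`, then `Q'` is the 2-truncation of `Q` along `G ∩ Q`; otherwise `Q'`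
  is the face `Q`, unchanged. -/
def deltaAux {n : ℕ} : {m : ℕ} → {K : PreAbstractSimplicialComplex (Facet n)} →
    TruncationSequence n m K → Finset (Facet n) → PreAbstractSimplicialComplex ℕ
  | _, _, cube, _ => ⊥
  | _, _, @truncate _ m K T G _ _, σ =>
    if Sum.inr m ∈ σ then T.deltaAux (σ.erase (Sum.inr m) ∪ G)
    else if σ ∪ G ∈ K ∧ (σ ∪ G).card = σ.card + 2 then
      T.deltaAux σ ⊔ cone (T.deltaAux (σ ∪ G)) m
    else T.deltaAux σ

/-- The simplicial complex `Δ(Q)` of a face `Q` of the 2-truncated cube obtained by `T`. -/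
def delta {n m : ℕ} {K : PreAbstractSimplicialComplex (Facet n)}
    (T : TruncationSequence n m K) (Q : Face K) : PreAbstractSimplicialComplex ℕ :=
  T.deltaAux Q.facets

end TruncationSequence

/-- A convex polytope: the convex hull of a finite set. -/
def IsConvexPolytope {d : ℕ} (P : Set (EuclideanSpace ℝ (Fin d))) : Prop :=
  ∃ s : Set (EuclideanSpace ℝ (Fin d)), s.Finite ∧ P = convexHull ℝ s

/-- The nonempty faces of a convex polytope `P` (including `P`), ordered by inclusion: the sets
where a linear functional attains its maximum on `P`. -/
abbrev GeometricFace {d : ℕ} (P : Set (EuclideanSpace ℝ (Fin d))) : Type :=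
  {Q : Set (EuclideanSpace ℝ (Fin d)) // Q.Nonempty ∧ IsExposed ℝ P Q}

end TwoTruncatedCube

end

/-!
In terms of facet sets, monotonicity says that `Δ` reverses inclusions, and each truncation
preserves this. A face is truncated along `G` exactly when its facet set lies in the link of `G`.
The link is closed under passing to subsets, so a face containing a truncated one is itself
truncated, and its cone contains the cone of the smaller face. Truncation never shrinks `Δ`; hence
the comparison is also inherited when only the larger face is truncated, and when only the smaller
face lies in the section facet.
-/

namespace TwoTruncatedCube

theorem cone_mono {V : Type*} [DecidableEq V] (w : V) :
    Monotone fun L : PreAbstractSimplicialComplex V => cone L w := by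
  rintro L M hLM σ (hσ | ⟨τ, hτ, rfl⟩)
  · exact Or.inl (hLM hσ)
  · exact Or.inr ⟨τ, hτ.imp_right (hLM ·), rfl⟩

section Link

variable {V : Type*} [DecidableEq V] {K : PreAbstractSimplicialComplex V} {G σ : Finset V}

/-- The link of the simplex `G` in `K`: the facet sets of the faces `Q` such that `G ∩ Q` is nonempty
and its codimension in `Q` is that of `G`. It is a set of finsets rather than a
`PreAbstractSimplicialComplex` so that it can contain the empty simplex, the facet set of the whole
polytope. -/
def link (K : PreAbstractSimplicialComplex V) (G : Finset V) : Set (Finset V) :=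
  {σ | σ ∪ G ∈ K ∧ Disjoint σ G}

theorem isLowerSet_link (hG : G.Nonempty) : IsLowerSet (link K G) := by
  rintro ρ σ hσρ ⟨hρK, hρG⟩
  exact ⟨(K.isRelLowerSet_faces hρK).2 (Finset.union_subset_union_left hσρ)
    (hG.mono Finset.subset_union_right), hρG.mono_left hσρ⟩

theorem mem_link_iff_card : σ ∈ link K G ↔ σ ∪ G ∈ K ∧ (σ ∪ G).card = σ.card + G.card :=
  and_congr_right' Finset.card_union_eq_card_add_card.symm

end Link

namespace TruncationSequence

variable {n m : ℕ} {K : PreAbstractSimplicialComplex (Facet n)} {T : TruncationSequence n m K}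
  {G : Finset (Facet n)} {hG : G ∈ K} {hcodim : G.card = 2} {σ : Finset (Facet n)}

theorem deltaAux_truncate_of_mem (hσ : Sum.inr m ∈ σ) :
    (T.truncate G hG hcodim).deltaAux σ = T.deltaAux (σ.erase (Sum.inr m) ∪ G) :=
  if_pos hσ

theorem deltaAux_truncate_of_mem_link (hσ : Sum.inr m ∉ σ) (hlink : σ ∈ link K G) :
    (T.truncate G hG hcodim).deltaAux σ = T.deltaAux σ ⊔ cone (T.deltaAux (σ ∪ G)) m := by
  rw [mem_link_iff_card, hcodim] at hlink
  rw [deltaAux, if_neg hσ, if_pos hlink]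

theorem deltaAux_truncate_of_notMem_link (hσ : Sum.inr m ∉ σ) (hlink : σ ∉ link K G) :
    (T.truncate G hG hcodim).deltaAux σ = T.deltaAux σ := by
  rw [mem_link_iff_card, hcodim] at hlink
  rw [deltaAux, if_neg hσ, if_neg hlink]

theorem deltaAux_le_deltaAux_truncate (hσ : Sum.inr m ∉ σ) :
    T.deltaAux σ ≤ (T.truncate G hG hcodim).deltaAux σ := by
  by_cases hlink : σ ∈ link K G
  · exact le_sup_left.trans_eq (deltaAux_truncate_of_mem_link hσ hlink).symm
  · exact (deltaAux_truncate_of_notMem_link hσ hlink).ge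

theorem antitone_deltaAux_truncate (hT : Antitone T.deltaAux) :
    Antitone (T.truncate G hG hcodim).deltaAux := by
  intro σ ρ hσρ
  by_cases hσ : Sum.inr m ∈ σ
  · rw [deltaAux_truncate_of_mem hσ, deltaAux_truncate_of_mem (hσρ hσ)]
    exact hT (Finset.union_subset_union_left (Finset.erase_subset_erase _ hσρ))
  by_cases hρ : Sum.inr m ∈ ρ
  · have hsub : σ ⊆ ρ.erase (Sum.inr m) ∪ G :=
      (Finset.subset_erase.2 ⟨hσρ, hσ⟩).trans Finset.subset_union_left
    rw [deltaAux_truncate_of_mem hρ]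
    exact (hT hsub).trans (deltaAux_le_deltaAux_truncate hσ)
  by_cases hρlink : ρ ∈ link K G
  · have hσlink : σ ∈ link K G := isLowerSet_link (K.isRelLowerSet_faces hG).1 hσρ hρlink
    rw [deltaAux_truncate_of_mem_link hσ hσlink, deltaAux_truncate_of_mem_link hρ hρlink]
    exact sup_le_sup (hT hσρ) (cone_mono m (hT (Finset.union_subset_union_left hσρ)))
  · rw [deltaAux_truncate_of_notMem_link hρ hρlink]
    exact (hT hσρ).trans (deltaAux_le_deltaAux_truncate hσ)

theorem antitone_deltaAux (T : TruncationSequence n m K) : Antitone T.deltaAux := by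
  induction T with
  | cube => exact antitone_const
  | truncate T G hG hcodim ih => exact antitone_deltaAux_truncate ih

theorem monotone_delta (T : TruncationSequence n m K) : Monotone T.delta :=
  fun _ _ hQ => T.antitone_deltaAux hQ

end TruncationSequence

end TwoTruncatedCube

/-- Let `T` be a sequence of 2-truncations that leads from the cube `I^n` to the 2-truncated cube
with dual boundary complex `K`. Then `Δ` is monotone on the faces of this combinatorial polytope,
and also on the faces of every convex polytope `P` that realizes it, that is, whose poset of nonempty
faces is identified by `φ` with the poset of faces of the combinatorial polytope. -/
theorem mainTheorem2 {n m : ℕ} {K : PreAbstractSimplicialComplex (TwoTruncatedCube.Facet n)}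
    (T : TwoTruncatedCube.TruncationSequence n m K) :
    (∀ Q₁ Q₂ : TwoTruncatedCube.Face K, Q₁ ≤ Q₂ → T.delta Q₁ ≤ T.delta Q₂) ∧
    (∀ (d : ℕ) (P : Set (EuclideanSpace ℝ (Fin d))), TwoTruncatedCube.IsConvexPolytope P →
      ∀ (φ : TwoTruncatedCube.GeometricFace P ≃o TwoTruncatedCube.Face K)
        (Q₁ Q₂ : TwoTruncatedCube.GeometricFace P),
        (Q₁ : Set (EuclideanSpace ℝ (Fin d))) ⊆ (Q₂ : Set (EuclideanSpace ℝ (Fin d))) →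
        T.delta (φ Q₁) ≤ T.delta (φ Q₂)) := by
  exact ⟨fun _ _ hQ => T.monotone_delta hQ,
    fun _ _ _ φ _ _ hQ => T.monotone_delta (φ.monotone hQ)⟩
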